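/- A permutation tableau is a Ferrers diagram of a partition into nonnegative parts (rows of length $0$ are allowed, so that the diagram may have empty rows at the bottom, and may have no boxes at all), whose boxes are filled with $0$s and $1$s such that (1) each column contains at least one $1$, and (2) no $0$ has both a $1$ above it in the same column and a $1$ to its left in the same row. Its length is the number of its rows (empty rows included) plus the number of its columns. There are finitely many permutation tableaux of each length $n$; choose one of them uniformly at random, and let $R_n$ be its number of rows. Then, as $n \to \infty$, $$\frac{R_n-(n+1)/2}{\sqrt{(n+1)/12}}\ \stackrel{d}{\longrightarrow}\ N(0,1),$$ where $N(0,1)$ is the standard normal distribution and $\stackrel{d}{\longrightarrow}$ denotes convergence in distribution. -/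

import Mathlib

/-- A permutation tableau of length `n`: a Ferrers diagram of a partition into `numRows`
nonnegative parts (so empty rows at the bottom are allowed), with a 0/1 filling of its boxes.
The box `(i, j)` lies in row `i` (counted from the top) and column `j` (counted from the left).
`ones` is the set of boxes filled with a `1`; the other boxes of `shape` are filled with a `0`. -/
@[ext]
structure PermutationTableau (n : ℕ) where
  /-- The boxes of the diagram. -/
  shape : YoungDiagram
  /-- The number of rows, empty rows included. -/
  numRows : ℕ
  /-- Every nonempty row is one of the `numRows` rows. -/
  colLen_le : shape.colLen 0 ≤ numRows
  /-- The boxes that contain a `1`. -/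
  ones : Finset (ℕ × ℕ)
  ones_subset : ones ⊆ shape.cells
  /-- The number of rows plus the number of columns is `n`. -/
  length_eq : numRows + shape.rowLen 0 = n
  /-- Every column contains at least one `1`. -/
  exists_one : ∀ j < shape.rowLen 0, ∃ i, (i, j) ∈ ones
  /-- No `0` has a `1` above it in the same column and a `1` to its left in the same row. -/
  no_bad_zero : ¬ ∃ i j, (i, j) ∈ shape ∧ (i, j) ∉ ones ∧
    (∃ i' < i, (i', j) ∈ ones) ∧ (∃ j' < j, (i, j') ∈ ones)

namespace PermutationTableau

theorem cells_subset {n : ℕ} (T : PermutationTableau n) :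
    T.shape.cells ⊆ Finset.range (n + 1) ×ˢ Finset.range (n + 1) := by
  rintro ⟨i, j⟩ h
  have h' : (i, j) ∈ T.shape := h
  have h1 := YoungDiagram.mem_iff_lt_colLen.1 h'
  have h2 := YoungDiagram.mem_iff_lt_rowLen.1 h'
  have h3 := T.shape.colLen_anti 0 j (Nat.zero_le j)
  have h4 := T.shape.rowLen_anti 0 i (Nat.zero_le i)
  have h5 := T.colLen_le
  have h6 := T.length_eq
  simp only [Finset.mem_product, Finset.mem_range]
  omega

instance (n : ℕ) : Finite (PermutationTableau n) := by
  let B := (Finset.range (n + 1) ×ˢ Finset.range (n + 1)).powerset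
  let f : PermutationTableau n → Fin (n + 1) × B × B := fun T =>
    (⟨T.numRows, by have := T.length_eq; omega⟩,
      ⟨T.shape.cells, Finset.mem_powerset.2 T.cells_subset⟩,
      ⟨T.ones, Finset.mem_powerset.2 (T.ones_subset.trans T.cells_subset)⟩)
  refine Finite.of_injective f fun S T h => ?_
  simp only [f, Prod.mk.injEq, Fin.mk.injEq, Subtype.mk.injEq] at h
  exact PermutationTableau.ext (YoungDiagram.ext h.2.1) h.1 h.2.2

/-- The tableau with `n` empty rows. -/
instance (n : ℕ) : Nonempty (PermutationTableau n) :=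
  have hr : (⊥ : YoungDiagram).rowLen 0 = 0 := by
    by_contra h
    exact YoungDiagram.notMem_bot (0, 0)
      (YoungDiagram.mem_iff_lt_rowLen.2 (Nat.pos_of_ne_zero h))
  have hc : (⊥ : YoungDiagram).colLen 0 = 0 := by
    by_contra h
    exact YoungDiagram.notMem_bot (0, 0)
      (YoungDiagram.mem_iff_lt_colLen.2 (Nat.pos_of_ne_zero h))
  ⟨{ shape := ⊥
     numRows := n
     colLen_le := by simp [hc]
     ones := ∅
     ones_subset := by simp
     length_eq := by simp [hr]
     exists_one := by simp [hr]
     no_bad_zero := by simp }⟩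

/-- All subsets of the finite set of tableaux are measurable. -/
instance (n : ℕ) : MeasurableSpace (PermutationTableau n) := ⊤

instance (n : ℕ) : DiscreteMeasurableSpace (PermutationTableau n) := ⟨fun _ => trivial⟩

/-- The uniform probability measure on the permutation tableaux of length `n`. -/
noncomputable def uniform (n : ℕ) : MeasureTheory.Measure (PermutationTableau n) :=
  ProbabilityTheory.uniformOn Set.univ

instance (n : ℕ) : MeasureTheory.IsProbabilityMeasure (uniform n) :=
  ProbabilityTheory.isProbabilityMeasure_uniformOn Set.finite_univ Set.univ_nonempty

end PermutationTableau

namespace PermutationTableau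

/-! The key fact is that $R_n$ has exactly the law of $\lceil U_1+\dots+U_n\rceil$ with $U_i$
independent and uniform on $[0,1]$; the limit then follows from the central limit theorem, as each
$U_i$ has mean $1/2$ and variance $1/12$.

To get this law, call a row unrestricted if none of its `0`s has a `1` above it. Every tableau of
length $n+1$ arises uniquely from one of length $n$, either by an empty bottom row or by a full left
column whose `1`s form a nonempty set of unrestricted rows (`extend_bijective`). So the generating
function $G_n(x,z)$, with $x$ marking rows and $z$ unrestricted rows, satisfies
$G_{n+1}(x,z)=z\,(G_n(x,z+1)+(x-1)G_n(x,z))$ (`genFun_succ`).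

For natural $z$ the recurrence is solved by $(1-x)^{n+z}\sum_k k^n\binom{z+k-1}{k}x^k$
(`genFun_eq_one_sub_pow_mul`). At $z=1$ this is an Eulerian polynomial, and the partial sums of its
coefficients are $\sum_j(-1)^j\binom nj(k-j)_+^n$, which is $n!\,P(U_1+\dots+U_n\le k)$
(`card_numRows_le`, `irwinHall_real_Iic`). As there are $n!$ tableaux, the two laws agree
(`map_numRows_eq_map_ceil`). -/

noncomputable instance (n : ℕ) : Fintype (PermutationTableau n) := Fintype.ofFinite _

/-! ### Unrestricted rows, and growing tableaux by a row or a column -/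

variable {n : ℕ}

open Classical in
/-- The rows without a restricted `0`, that is, a `0` that has a `1` above it. -/
noncomputable def unrestrictedRows (T : PermutationTableau n) : Finset ℕ :=
  (Finset.range T.numRows).filter fun i =>
    ¬ ∃ j, (i, j) ∈ T.shape ∧ (i, j) ∉ T.ones ∧ ∃ i' < i, (i', j) ∈ T.ones

theorem mem_unrestrictedRows {T : PermutationTableau n} {i : ℕ} :
    i ∈ T.unrestrictedRows ↔ i < T.numRows ∧
      ∀ j, (i, j) ∈ T.shape → (∃ i' < i, (i', j) ∈ T.ones) → (i, j) ∈ T.ones := by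
  classical
  simp only [unrestrictedRows, Finset.mem_filter, Finset.mem_range]
  refine and_congr_right fun _ => ⟨fun h j h1 h2 => ?_, fun h ⟨j, h1, h2, h3⟩ => h2 (h j h1 h3)⟩
  by_contra h3
  exact h ⟨j, h1, h3, h2⟩

theorem mem_shape_of_mem_ones {T : PermutationTableau n} {c : ℕ × ℕ} (h : c ∈ T.ones) :
    c ∈ T.shape := T.ones_subset h

theorem lt_numRows_of_mem {T : PermutationTableau n} {i j : ℕ} (h : (i, j) ∈ T.shape) :
    i < T.numRows :=
  (YoungDiagram.mem_iff_lt_colLen.1 h).trans_le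
    ((T.shape.colLen_anti 0 j (Nat.zero_le j)).trans T.colLen_le)

/-- Append an empty row at the bottom. -/
def addRow (T : PermutationTableau n) : PermutationTableau (n + 1) :=
  { T with
    numRows := T.numRows + 1
    colLen_le := T.colLen_le.trans (Nat.le_succ _)
    length_eq := by have := T.length_eq; omega }

theorem addRow_injective : Function.Injective (addRow (n := n)) := fun S T h => by
  have h1 := congrArg PermutationTableau.shape h
  have h2 := congrArg PermutationTableau.numRows h
  have h3 := congrArg PermutationTableau.ones h
  exact PermutationTableau.ext h1 (Nat.succ_injective h2) h3

theorem unrestrictedRows_addRow (T : PermutationTableau n) :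
    T.addRow.unrestrictedRows = insert T.numRows T.unrestrictedRows := by
  ext i
  simp only [Finset.mem_insert, mem_unrestrictedRows, addRow]
  constructor
  · rintro ⟨h1, h2⟩
    rcases Nat.lt_succ_iff_lt_or_eq.1 h1 with h | h
    · exact Or.inr ⟨h, h2⟩
    · exact Or.inl h
  · rintro (rfl | ⟨h1, h2⟩)
    · exact ⟨Nat.lt_succ_self _, fun j hj => absurd (lt_numRows_of_mem hj) (lt_irrefl _)⟩
    · exact ⟨h1.trans (Nat.lt_succ_self _), h2⟩

theorem card_unrestrictedRows_addRow (T : PermutationTableau n) :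
    T.addRow.unrestrictedRows.card = T.unrestrictedRows.card + 1 := by
  rw [unrestrictedRows_addRow, Finset.card_insert_of_notMem]
  simp [mem_unrestrictedRows]

/-- The boxes of a new left column with rows in `S`, followed by the boxes of `C`. -/
def consColumn (S : Finset ℕ) (C : Finset (ℕ × ℕ)) : Finset (ℕ × ℕ) :=
  S.image (fun i => (i, 0)) ∪ C.image fun c => (c.1, c.2 + 1)

@[simp]
theorem mem_consColumn_zero {S : Finset ℕ} {C : Finset (ℕ × ℕ)} {i : ℕ} :
    (i, 0) ∈ consColumn S C ↔ i ∈ S := by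
  simp [consColumn]

@[simp]
theorem mem_consColumn_succ {S : Finset ℕ} {C : Finset (ℕ × ℕ)} {i j : ℕ} :
    (i, j + 1) ∈ consColumn S C ↔ (i, j) ∈ C := by
  simp [consColumn]

/-- Add a full column on the left to a Young diagram with at most `r` nonempty rows. -/
def addColumnShape (μ : YoungDiagram) (r : ℕ) (h : μ.colLen 0 ≤ r) : YoungDiagram where
  cells := consColumn (Finset.range r) μ.cells
  isLowerSet := by
    rintro ⟨i, j⟩ ⟨i', j'⟩ ⟨hi, hj⟩ hm
    simp only at hi hj
    have key : ∀ a b, (a, b) ∈ μ → a < r := fun a b hab =>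
      ((YoungDiagram.mem_iff_lt_colLen.1 hab).trans_le (μ.colLen_anti 0 b (Nat.zero_le b))).trans_le
        h
    rcases j' with _ | j' <;> rcases j with _ | j
    · simp only [Finset.mem_coe, mem_consColumn_zero, Finset.mem_range] at hm ⊢
      omega
    · simp only [Finset.mem_coe, mem_consColumn_zero, mem_consColumn_succ, Finset.mem_range] at hm ⊢
      have := key _ _ hm
      omega
    · omega
    · simp only [Finset.mem_coe, mem_consColumn_succ] at hm ⊢
      exact μ.up_left_mem hi (Nat.succ_le_succ_iff.1 hj) hm

@[simp]
theorem mem_addColumnShape_zero {μ : YoungDiagram} {r : ℕ} {h : μ.colLen 0 ≤ r} {i : ℕ} :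
    (i, 0) ∈ addColumnShape μ r h ↔ i < r := by
  rw [← YoungDiagram.mem_cells]
  simp [addColumnShape]

@[simp]
theorem mem_addColumnShape_succ {μ : YoungDiagram} {r : ℕ} {h : μ.colLen 0 ≤ r} {i j : ℕ} :
    (i, j + 1) ∈ addColumnShape μ r h ↔ (i, j) ∈ μ := by
  rw [← YoungDiagram.mem_cells]
  simp [addColumnShape]

theorem rowLen_eq_of_forall {μ : YoungDiagram} {i m : ℕ} (h : ∀ j, (i, j) ∈ μ ↔ j < m) :
    μ.rowLen i = m := by
  refine eq_of_forall_lt_iff fun j => ?_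
  rw [← YoungDiagram.mem_iff_lt_rowLen, h]

theorem colLen_eq_of_forall {μ : YoungDiagram} {j m : ℕ} (h : ∀ i, (i, j) ∈ μ ↔ i < m) :
    μ.colLen j = m := by
  refine eq_of_forall_lt_iff fun i => ?_
  rw [← YoungDiagram.mem_iff_lt_colLen, h]

theorem rowLen_addColumnShape {μ : YoungDiagram} {r : ℕ} {h : μ.colLen 0 ≤ r} (hr : 0 < r) :
    (addColumnShape μ r h).rowLen 0 = μ.rowLen 0 + 1 := by
  refine rowLen_eq_of_forall fun j => ?_
  rcases j with _ | j
  · simpa using hr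
  · rw [mem_addColumnShape_succ, YoungDiagram.mem_iff_lt_rowLen, Nat.succ_lt_succ_iff]

/-- Add a full column on the left, with the `1`s in a nonempty set of unrestricted rows. -/
def addColumn (T : PermutationTableau n) (S : Finset ℕ) (hS : S ⊆ T.unrestrictedRows)
    (hne : S.Nonempty) : PermutationTableau (n + 1) where
  shape := addColumnShape T.shape T.numRows T.colLen_le
  numRows := T.numRows
  colLen_le := by
    rw [colLen_eq_of_forall fun i => mem_addColumnShape_zero]
  ones := consColumn S T.ones
  ones_subset := by
    rintro ⟨i, _ | j⟩ h
    · rw [YoungDiagram.mem_cells, mem_addColumnShape_zero]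
      exact (mem_unrestrictedRows.1 (hS (mem_consColumn_zero.1 h))).1
    · rw [YoungDiagram.mem_cells, mem_addColumnShape_succ]
      exact mem_shape_of_mem_ones (mem_consColumn_succ.1 h)
  length_eq := by
    obtain ⟨i, hi⟩ := hne
    have h1 := (mem_unrestrictedRows.1 (hS hi)).1
    rw [rowLen_addColumnShape (by omega)]
    have := T.length_eq
    omega
  exists_one := by
    obtain ⟨i, hi⟩ := hne
    have h1 := (mem_unrestrictedRows.1 (hS hi)).1
    rw [rowLen_addColumnShape (by omega)]
    rintro (_ | j) hj
    · exact ⟨i, mem_consColumn_zero.2 hi⟩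
    · obtain ⟨i', hi'⟩ := T.exists_one j (by omega)
      exact ⟨i', mem_consColumn_succ.2 hi'⟩
  no_bad_zero := by
    rintro ⟨i, _ | j, h1, h2, ⟨i', hi', h3⟩, ⟨j', hj', h4⟩⟩
    · omega
    · rw [mem_addColumnShape_succ] at h1
      rw [mem_consColumn_succ] at h2 h3
      rcases j' with _ | j'
      -- The `1` to the left is in the new column, so its row is unrestricted and has no `0` below a
      -- `1`.
      · exact h2 ((mem_unrestrictedRows.1 (hS (mem_consColumn_zero.1 h4))).2 j h1 ⟨i', hi', h3⟩)
      · exact T.no_bad_zero ⟨i, j, h1, h2, ⟨i', hi', h3⟩,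
          ⟨j', by omega, mem_consColumn_succ.1 h4⟩⟩

/-- The members of `U` that lie in `S` or below all elements of `S`. -/
def weakLower (U S : Finset ℕ) : Finset ℕ :=
  U.filter fun i => i ∈ S ∨ ∀ j ∈ S, i < j

/-- In the new column the `0`s with a `1` above them are those below the topmost element of `S`;
exactly their rows become restricted. -/
theorem unrestrictedRows_addColumn (T : PermutationTableau n) (S : Finset ℕ)
    (hS : S ⊆ T.unrestrictedRows) (hne : S.Nonempty) :
    (T.addColumn S hS hne).unrestrictedRows = weakLower T.unrestrictedRows S := by
  ext i
  simp only [weakLower, Finset.mem_filter, mem_unrestrictedRows, addColumn]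
  constructor
  · rintro ⟨h1, h2⟩
    refine ⟨⟨h1, fun j hj hj' => ?_⟩, ?_⟩
    · simpa using h2 (j + 1) (by simpa using hj) (by simpa using hj')
    · by_contra! h
      obtain ⟨h3, i', h4, h5⟩ := h
      refine h3 (mem_consColumn_zero.1 (h2 0 (by simpa using h1) ⟨i', ?_, by simpa using h4⟩))
      exact lt_of_le_of_ne h5 fun h => h3 (h ▸ h4)
  · rintro ⟨⟨h1, h2⟩, h3⟩
    refine ⟨h1, ?_⟩
    rintro (_ | j) hj ⟨i', hi', hi''⟩
    · simp only [mem_consColumn_zero] at hi'' ⊢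
      rcases h3 with h3 | h3
      · exact h3
      · exact absurd (h3 _ hi'') (by omega)
    · simp only [mem_consColumn_succ, mem_addColumnShape_succ] at *
      exact h2 j hj ⟨i', hi', hi''⟩

/-- The columns of a set of boxes, without the leftmost one. -/
noncomputable def tailColumns (C : Finset (ℕ × ℕ)) : Finset (ℕ × ℕ) :=
  C.preimage (fun c => (c.1, c.2 + 1)) fun _ _ _ _ h => by
    simp only [Prod.mk.injEq, Nat.succ_inj] at h
    exact Prod.ext h.1 h.2

@[simp]
theorem mem_tailColumns {C : Finset (ℕ × ℕ)} {i j : ℕ} :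
    (i, j) ∈ tailColumns C ↔ (i, j + 1) ∈ C :=
  Finset.mem_preimage

/-- Delete the leftmost column of a Young diagram. -/
noncomputable def tailShape (μ : YoungDiagram) : YoungDiagram where
  cells := tailColumns μ.cells
  isLowerSet := by
    rintro ⟨i, j⟩ ⟨i', j'⟩ ⟨hi, hj⟩ hm
    simp only [Finset.mem_coe, mem_tailColumns] at hm ⊢
    exact μ.up_left_mem hi (Nat.succ_le_succ hj) hm

@[simp]
theorem mem_tailShape {μ : YoungDiagram} {i j : ℕ} :
    (i, j) ∈ tailShape μ ↔ (i, j + 1) ∈ μ := by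
  rw [← YoungDiagram.mem_cells]
  simp [tailShape]

/-- Delete the leftmost column of a tableau in which this column meets every row. -/
noncomputable def dropColumn (T : PermutationTableau (n + 1)) (h : T.shape.colLen 0 = T.numRows) :
    PermutationTableau n where
  shape := tailShape T.shape
  numRows := T.numRows
  colLen_le := by
    refine le_of_forall_lt fun i hi => ?_
    rw [← YoungDiagram.mem_iff_lt_colLen, mem_tailShape] at hi
    exact lt_numRows_of_mem hi
  ones := tailColumns T.ones
  ones_subset := by
    rintro ⟨i, j⟩ hij
    exact mem_tailColumns.2 (T.ones_subset (mem_tailColumns.1 hij))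
  length_eq := by
    have h1 : (tailShape T.shape).rowLen 0 = T.shape.rowLen 0 - 1 :=
      rowLen_eq_of_forall fun j => by
        rw [mem_tailShape, YoungDiagram.mem_iff_lt_rowLen]
        omega
    have h2 := T.length_eq
    -- Without columns, `h` would leave no rows either, contradicting the positive length; hence the
    -- subtraction in `h1` does not truncate.
    have h3 : 0 < T.shape.rowLen 0 ↔ 0 < T.shape.colLen 0 := by
      rw [← YoungDiagram.mem_iff_lt_rowLen, ← YoungDiagram.mem_iff_lt_colLen]
    omega
  exists_one := by
    intro j hj
    rw [← YoungDiagram.mem_iff_lt_rowLen, mem_tailShape, YoungDiagram.mem_iff_lt_rowLen] at hj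
    obtain ⟨i, hi⟩ := T.exists_one _ hj
    exact ⟨i, mem_tailColumns.2 hi⟩
  no_bad_zero := by
    rintro ⟨i, j, h1, h2, ⟨i', hi', h3⟩, ⟨j', hj', h4⟩⟩
    simp only [mem_tailShape, mem_tailColumns] at h1 h2 h3 h4
    exact T.no_bad_zero ⟨i, j + 1, h1, h2, ⟨i', hi', h3⟩, ⟨j' + 1, by omega, h4⟩⟩

/-- If the bottom row is empty, remove it. Otherwise the left column meets every row and can be
removed; a row with a `1` in that column is unrestricted in what remains, because of `no_bad_zero`.
-/
theorem exists_addRow_or_addColumn (T : PermutationTableau (n + 1)) :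
    (∃ T', addRow T' = T) ∨ ∃ (T' : PermutationTableau n) (S : Finset ℕ)
      (hS : S ⊆ T'.unrestrictedRows) (hne : S.Nonempty), T'.addColumn S hS hne = T := by
  rcases T.colLen_le.lt_or_eq with h | h
  · refine Or.inl ⟨{ T with
      numRows := T.numRows - 1
      colLen_le := by omega
      length_eq := by have := T.length_eq; omega }, ?_⟩
    exact PermutationTableau.ext rfl (Nat.sub_add_cancel (by omega)) rfl
  · right
    have hlen := T.length_eq
    have h3 : 0 < T.shape.rowLen 0 ↔ 0 < T.shape.colLen 0 := by
      rw [← YoungDiagram.mem_iff_lt_rowLen, ← YoungDiagram.mem_iff_lt_colLen]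
    have hmem : ∀ {i}, i ∈ (Finset.range T.numRows).filter (fun i => (i, 0) ∈ T.ones) ↔
        (i, 0) ∈ T.ones := fun {i} => by
      simp only [Finset.mem_filter, Finset.mem_range, and_iff_right_iff_imp]
      exact fun hi => lt_numRows_of_mem (mem_shape_of_mem_ones hi)
    refine ⟨T.dropColumn h, (Finset.range T.numRows).filter (fun i => (i, 0) ∈ T.ones), ?_, ?_, ?_⟩
    · intro i hi
      rw [hmem] at hi
      refine mem_unrestrictedRows.2 ⟨lt_numRows_of_mem (T := T) (mem_shape_of_mem_ones hi), ?_⟩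
      rintro j hj ⟨i', hi', hj'⟩
      simp only [dropColumn, mem_tailShape, mem_tailColumns] at hj hj' ⊢
      by_contra hc
      exact T.no_bad_zero ⟨i, j + 1, hj, hc, ⟨i', hi', hj'⟩, ⟨0, Nat.succ_pos _, hi⟩⟩
    · obtain ⟨i, hi⟩ := T.exists_one 0 (by omega)
      exact ⟨i, hmem.2 hi⟩
    · refine PermutationTableau.ext ?_ rfl ?_
      · refine YoungDiagram.ext (Finset.ext ?_)
        rintro ⟨i, _ | j⟩
        · rw [YoungDiagram.mem_cells, YoungDiagram.mem_cells,
            YoungDiagram.mem_iff_lt_colLen (μ := T.shape), h]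
          exact mem_addColumnShape_zero (h := (T.dropColumn h).colLen_le)
        · exact (mem_addColumnShape_succ (h := (T.dropColumn h).colLen_le)).trans mem_tailShape
      · refine Finset.ext ?_
        rintro ⟨i, _ | j⟩
        · exact mem_consColumn_zero.trans hmem
        · exact mem_consColumn_succ.trans mem_tailColumns

theorem addRow_ne_addColumn (T T' : PermutationTableau n) (S : Finset ℕ)
    (hS : S ⊆ T'.unrestrictedRows) (hne : S.Nonempty) : T.addRow ≠ T'.addColumn S hS hne := by
  intro h
  have h2 : T.numRows + 1 = T'.numRows := congrArg PermutationTableau.numRows h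
  have h1 : (T.numRows, 0) ∈ (T'.addColumn S hS hne).shape :=
    (mem_addColumnShape_zero (h := T'.colLen_le)).2 (by omega)
  rw [← h] at h1
  exact absurd (lt_numRows_of_mem (T := T) h1) (lt_irrefl _)

/-- The choice of a tableau and of a nonempty set of its unrestricted rows. -/
abbrev ColumnData (n : ℕ) : Type :=
  Σ T : PermutationTableau n, {S : Finset ℕ // S ∈ T.unrestrictedRows.powerset.erase ∅}

/-- The extension of a tableau by a row or by a column. -/
def extend : PermutationTableau n ⊕ ColumnData n → PermutationTableau (n + 1) :=
  Sum.elim addRow fun p => p.1.addColumn p.2.1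
    (Finset.mem_powerset.1 (Finset.mem_of_mem_erase p.2.2))
    (Finset.nonempty_iff_ne_empty.2 (Finset.ne_of_mem_erase p.2.2))

theorem extend_bijective : Function.Bijective (extend (n := n)) := by
  constructor
  · refine addRow_injective.sumElim ?_ fun _ _ => addRow_ne_addColumn _ _ _ _ _
    rintro ⟨T, S, hS⟩ ⟨T', S', hS'⟩ h
    simp only at h
    have h1 := congrArg PermutationTableau.shape h
    have h2 := congrArg PermutationTableau.numRows h
    have h3 := congrArg PermutationTableau.ones h
    have hT : T = T' := by
      refine PermutationTableau.ext (YoungDiagram.ext (Finset.ext fun c => ?_)) h2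
        (Finset.ext fun c => ?_)
      · have := congrArg (fun μ : YoungDiagram => (c.1, c.2 + 1) ∈ μ) h1
        simpa [addColumn] using this
      · have := congrArg (fun μ : Finset (ℕ × ℕ) => (c.1, c.2 + 1) ∈ μ) h3
        simpa [addColumn] using this
    subst hT
    have hSS : S = S' := Finset.ext fun i => by
      have := congrArg (fun μ : Finset (ℕ × ℕ) => (i, 0) ∈ μ) h3
      simpa [addColumn] using this
    subst hSS
    rfl
  · intro T
    rcases exists_addRow_or_addColumn T with ⟨T', h⟩ | ⟨T', S, hS, hne, h⟩
    · exact ⟨Sum.inl T', h⟩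
    · exact ⟨Sum.inr ⟨T', S, Finset.mem_erase.2 ⟨hne.ne_empty, Finset.mem_powerset.2 hS⟩⟩, h⟩

/-! ### The generating function and its recurrence -/

variable {R : Type*} [CommRing R]

/-- Induct by adding a new maximum `a` to `U`. Putting `a` into `S` adds just `a` to `weakLower`, a
factor `z`; leaving it out changes nothing, unless `S` is empty. -/
theorem sum_pow_card_weakLower (U : Finset ℕ) (z : R) :
    ∑ S ∈ U.powerset.erase ∅, z ^ (weakLower U S).card = z * ((z + 1) ^ U.card - z ^ U.card) := by
  suffices h : ∑ S ∈ U.powerset, z ^ (weakLower U S).card =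
      z * ((z + 1) ^ U.card - z ^ U.card) + z ^ U.card by
    rw [← Finset.add_sum_erase _ _ (Finset.empty_mem_powerset U)] at h
    have h0 : weakLower U ∅ = U := by simp [weakLower]
    rw [h0] at h
    linear_combination h
  induction U using Finset.induction_on_max with
  | empty => simp [weakLower]
  | insert a U ha ih =>
    have haU : a ∉ U := fun h => lt_irrefl _ (ha a h)
    rw [Finset.sum_powerset_insert haU, Finset.card_insert_of_notMem haU]
    have h1 : ∀ S ∈ U.powerset.erase ∅, weakLower (insert a U) S = weakLower U S := by
      intro S hS
      obtain ⟨h1, h2⟩ := Finset.mem_erase.1 hS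
      rw [Finset.mem_powerset] at h2
      obtain ⟨b, hb⟩ := Finset.nonempty_iff_ne_empty.2 h1
      rw [weakLower, Finset.filter_insert, if_neg, weakLower]
      rintro (h | h)
      · exact haU (h2 h)
      · exact lt_asymm (h b hb) (ha b (h2 hb))
    have h2 : ∀ S ∈ U.powerset, weakLower (insert a U) (insert a S) = insert a (weakLower U S) := by
      intro S hS
      rw [weakLower, Finset.filter_insert, if_pos (Or.inl (Finset.mem_insert_self a S)), weakLower]
      congr 1
      refine Finset.filter_congr fun i hi => ?_
      have := ha i hi
      simp only [Finset.mem_insert, forall_eq_or_imp, this.ne, false_or, this, true_and]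
    have h3 : ∀ S ∈ U.powerset, z ^ (weakLower (insert a U) (insert a S)).card =
        z * z ^ (weakLower U S).card := by
      intro S hS
      rw [h2 S hS, Finset.card_insert_of_notMem, pow_succ']
      exact fun h => haU (Finset.mem_filter.1 h).1
    have h0 : ∀ V, weakLower V ∅ = V := fun V => by simp [weakLower]
    rw [Finset.sum_congr rfl h3, ← Finset.mul_sum, ih,
      ← Finset.add_sum_erase _ _ (Finset.empty_mem_powerset U),
      Finset.sum_congr rfl fun S hS => by rw [h1 S hS]]
    rw [← Finset.add_sum_erase _ _ (Finset.empty_mem_powerset U), h0] at ih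
    rw [h0, Finset.card_insert_of_notMem haU]
    linear_combination ih

/-- The generating function of tableaux by rows and unrestricted rows. -/
noncomputable def genFun (n : ℕ) (x z : R) : R :=
  ∑ T : PermutationTableau n, x ^ T.numRows * z ^ T.unrestrictedRows.card

/-- A new row contributes `x * z * genFun n x z`, and a new column contributes `z * (genFun n x (z +
1) - genFun n x z)`. -/
theorem genFun_succ (n : ℕ) (x z : R) :
    genFun (n + 1) x z = z * (genFun n x (z + 1) + (x - 1) * genFun n x z) := by
  rw [genFun, ← Fintype.sum_bijective extend extend_bijective
    (fun p => x ^ (extend p).numRows * z ^ (extend p).unrestrictedRows.card) _ fun _ => rfl]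
  rw [Fintype.sum_sum_type, Fintype.sum_sigma]
  have h : ∀ T : PermutationTableau n,
      ∑ S : {S : Finset ℕ // S ∈ T.unrestrictedRows.powerset.erase ∅},
        x ^ (extend (Sum.inr ⟨T, S⟩)).numRows *
          z ^ (extend (Sum.inr ⟨T, S⟩)).unrestrictedRows.card =
      x ^ T.numRows * (z * ((z + 1) ^ T.unrestrictedRows.card - z ^ T.unrestrictedRows.card)) := by
    intro T
    rw [← sum_pow_card_weakLower, Finset.mul_sum,
      ← Finset.sum_coe_sort (T.unrestrictedRows.powerset.erase ∅)]
    refine Finset.sum_congr rfl fun S _ => ?_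
    simp only [extend, Sum.elim_inr, unrestrictedRows_addColumn]
    rfl
  simp only [h]
  simp only [extend, Sum.elim_inl, card_unrestrictedRows_addRow]
  simp only [genFun, Finset.mul_sum, ← Finset.sum_add_distrib]
  refine Finset.sum_congr rfl fun T _ => ?_
  rw [show T.addRow.numRows = T.numRows + 1 from rfl]
  ring

theorem genFun_zero (x z : R) : genFun 0 x z = 1 := by
  have h0 : ∀ T : PermutationTableau 0, T.numRows = 0 := fun T => by
    have := T.length_eq
    omega
  have hs : ∀ T : PermutationTableau 0, T.shape.cells = ∅ := fun T =>
    Finset.eq_empty_of_forall_notMem fun c hc => by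
      have := lt_numRows_of_mem (T := T) (i := c.1) (j := c.2) hc
      have := h0 T
      omega
  have : Subsingleton (PermutationTableau 0) := ⟨fun S T =>
    PermutationTableau.ext (YoungDiagram.ext ((hs S).trans (hs T).symm)) ((h0 S).trans (h0 T).symm)
      ((Finset.subset_empty.1 (hs S ▸ S.ones_subset)).trans
        (Finset.subset_empty.1 (hs T ▸ T.ones_subset)).symm)⟩
  obtain ⟨T⟩ : Nonempty (PermutationTableau 0) := inferInstance
  have hu : T.unrestrictedRows = ∅ :=
    Finset.eq_empty_of_forall_notMem fun i hi => by
      have := (mem_unrestrictedRows.1 hi).1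
      have := h0 T
      omega
  rw [genFun, Fintype.sum_subsingleton _ T, hu, h0]
  simp

end PermutationTableau

/-! ### Solving the recurrence by power series, and counting tableaux by rows -/

namespace PermutationTableau

open PowerSeries

theorem mul_multichoose_succ (z k : ℕ) :
    z * (z + 1).multichoose k = (z + k) * z.multichoose k := by
  rcases z with _ | y
  · rcases k with _ | k <;> simp
  · rw [Nat.multichoose_eq, Nat.multichoose_eq]
    have h := Nat.choose_mul_succ_eq (y + k) k
    rw [show y + k + 1 - k = y + 1 by omega] at h
    rw [show y + 1 + 1 + k - 1 = y + k + 1 by omega, show y + 1 + k - 1 = y + k by omega]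
    linarith

/-- The power series with coefficients `k ^ n * multichoose z k`. -/
noncomputable def worpitzkySeries (n z : ℕ) : ℝ⟦X⟧ :=
  PowerSeries.mk fun k => (k : ℝ) ^ n * (z.multichoose k : ℝ)

theorem mul_worpitzkySeries_sub (n z : ℕ) :
    (z : ℝ⟦X⟧) * (worpitzkySeries n (z + 1) - worpitzkySeries n z) = worpitzkySeries (n + 1) z := by
  ext k
  have h : (z : ℝ) * ((z + 1).multichoose k : ℝ) = (z + k) * (z.multichoose k : ℝ) := by
    exact_mod_cast mul_multichoose_succ z k
  rw [← map_natCast (C (R := ℝ)), coeff_C_mul, map_sub]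
  simp only [worpitzkySeries, coeff_mk]
  linear_combination (k : ℝ) ^ n * h

/-- The negative binomial series: Pascal's rule for `multichoose` makes each factor `1 - X` lower
`z` by one. -/
theorem one_sub_pow_mul_worpitzkySeries_zero (z : ℕ) :
    (1 - X : ℝ⟦X⟧) ^ z * worpitzkySeries 0 z = 1 := by
  induction z with
  | zero =>
    ext k
    rcases k with _ | k <;> simp [worpitzkySeries, coeff_one]
  | succ z ih =>
    suffices h : (1 - X : ℝ⟦X⟧) * worpitzkySeries 0 (z + 1) = worpitzkySeries 0 z by
      rw [pow_succ, mul_assoc, h, ih]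
    ext k
    rw [sub_mul, one_mul, map_sub]
    rcases k with _ | k
    · simp [worpitzkySeries]
    · simp [worpitzkySeries, coeff_succ_X_mul, Nat.multichoose_succ_succ]

theorem genFun_eq_one_sub_pow_mul (n z : ℕ) :
    genFun n (X : ℝ⟦X⟧) (z : ℝ⟦X⟧) = (1 - X) ^ (n + z) * worpitzkySeries n z := by
  induction n generalizing z with
  | zero => rw [genFun_zero, Nat.zero_add, one_sub_pow_mul_worpitzkySeries_zero]
  | succ n ih =>
    have h := ih (z + 1)
    push_cast at h
    rw [genFun_succ, h, ih z, ← mul_worpitzkySeries_sub]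
    ring

/-- The truncated power `s ↦ s ^ n` for `0 ≤ s`, and `0` for `s < 0`. -/
noncomputable def truncPow (n : ℕ) (s : ℝ) : ℝ := if 0 ≤ s then s ^ n else 0

/-- The alternating sum of truncated powers, a `B`-spline formula. -/
noncomputable def altTruncPow (n : ℕ) (t : ℝ) : ℝ :=
  ∑ j ∈ Finset.range (n + 1), (-1) ^ j * (n.choose j : ℝ) * truncPow n (t - j)

theorem card_numRows_le (n k : ℕ) :
    ((Finset.univ.filter fun T : PermutationTableau n => T.numRows ≤ k).card : ℝ) =
      altTruncPow n k := by
  have h := genFun_eq_one_sub_pow_mul n 1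
  rw [Nat.cast_one, genFun] at h
  have h2 := congrArg (fun f : ℝ⟦X⟧ => coeff k (f * PowerSeries.mk 1)) h
  simp only [one_pow, mul_one, Finset.sum_mul, map_sum, coeff_X_pow_mul', coeff_mk, Pi.one_apply]
    at h2
  rw [Finset.sum_boole] at h2
  rw [h2]
  -- Multiplying by `∑ X ^ k` turns coefficients into partial sums and cancels one factor `1 - X`.
  have h3 : (1 - X : ℝ⟦X⟧) ^ (n + 1) * worpitzkySeries n 1 * PowerSeries.mk 1 =
      (1 - X) ^ n * worpitzkySeries n 1 := by
    linear_combination (1 - X : ℝ⟦X⟧) ^ n * worpitzkySeries n 1 * mk_one_mul_one_sub_eq_one ℝ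
  have h4 : (1 - X : ℝ⟦X⟧) ^ n =
      ∑ j ∈ Finset.range (n + 1), C ((-1) ^ j * (n.choose j : ℝ)) * X ^ j := by
    rw [sub_eq_neg_add, add_pow]
    refine Finset.sum_congr rfl fun j _ => ?_
    rw [neg_pow, one_pow, map_mul, map_pow, map_neg, map_one, map_natCast]
    ring
  rw [h3, h4, Finset.sum_mul, map_sum, altTruncPow]
  refine Finset.sum_congr rfl fun j _ => ?_
  rw [mul_assoc (C _), coeff_C_mul, coeff_X_pow_mul', truncPow]
  simp only [sub_nonneg, Nat.cast_le]
  split_ifs with hj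
  · simp [worpitzkySeries, Nat.cast_sub hj, Nat.multichoose_one]
  · rfl

/-- At `x = 1` the second term of the recurrence vanishes, which leaves a rising factorial in `z`.
-/
theorem card_eq_factorial (n : ℕ) : Fintype.card (PermutationTableau n) = n.factorial := by
  have h : ∀ n z : ℕ, genFun n (1 : ℤ) (z : ℤ) = (z.ascFactorial n : ℤ) := by
    intro n
    induction n with
    | zero => intro z; simp [genFun_zero]
    | succ n ih =>
      intro z
      have h := ih (z + 1)
      push_cast at h
      rw [genFun_succ, h, sub_self, zero_mul, add_zero]
      rw [Nat.ascFactorial_succ, ← Nat.succ_ascFactorial]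
      push_cast
      rfl
  have h1 := h n 1
  simp only [genFun, one_pow, Nat.cast_one, mul_one, Finset.sum_const, Nat.one_ascFactorial,
    nsmul_eq_mul, Finset.card_univ] at h1
  exact_mod_cast h1

end PermutationTableau

/-! ### The Irwin-Hall distribution and the exact law of the number of rows -/

namespace PermutationTableau

open MeasureTheory ProbabilityTheory

theorem truncPow_monotone (n : ℕ) : Monotone (truncPow n) := by
  intro s t hst
  simp only [truncPow]
  split_ifs with h1 h2 h2
  · exact pow_le_pow_left₀ h1 hst n
  · exact absurd (h1.trans hst) h2
  · exact pow_nonneg h2 n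
  · exact le_rfl

theorem intervalIntegrable_truncPow (n : ℕ) (a b : ℝ) :
    IntervalIntegrable (truncPow n) volume a b :=
  (truncPow_monotone n).intervalIntegrable

theorem integral_truncPow_zero (n : ℕ) (b : ℝ) :
    ∫ s in (0 : ℝ)..b, truncPow n s = truncPow (n + 1) b / (n + 1) := by
  rcases le_or_gt 0 b with hb | hb
  · rw [intervalIntegral.integral_congr (g := fun s => s ^ n), integral_pow, truncPow, if_pos hb]
    · simp
    · intro s hs
      rw [Set.uIcc_of_le hb] at hs
      exact if_pos hs.1
  · rw [truncPow, if_neg hb.not_ge, zero_div]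
    refine intervalIntegral.integral_zero_ae ?_
    -- The point `0` is discarded because `truncPow 0 0 = 1`.
    filter_upwards [compl_mem_ae_iff.2 (measure_singleton (0 : ℝ))] with s hs hs'
    rw [Set.uIoc_of_ge hb.le] at hs'
    exact if_neg (lt_of_le_of_ne hs'.2 hs).not_ge

theorem integral_truncPow (n : ℕ) (a b : ℝ) :
    ∫ s in a..b, truncPow n s = (truncPow (n + 1) b - truncPow (n + 1) a) / (n + 1) := by
  rw [← intervalIntegral.integral_interval_sub_left (intervalIntegrable_truncPow n 0 b)
    (intervalIntegrable_truncPow n 0 a), integral_truncPow_zero, integral_truncPow_zero, sub_div]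

/-- Integrating a truncated power over a unit interval gives a difference of two consecutive shifts,
which Pascal's rule absorbs into the binomials of order `n + 1`. This is the effect of adding one
uniform variable. -/
theorem integral_altTruncPow (n : ℕ) (t : ℝ) :
    ∫ u in (0 : ℝ)..1, altTruncPow n (t - u) = altTruncPow (n + 1) t / (n + 1) := by
  have hi : ∀ j : ℕ, IntervalIntegrable (fun u : ℝ => truncPow n (t - u - j)) volume 0 1 :=
    fun j => by
      refine Antitone.intervalIntegrable fun u v huv => truncPow_monotone n ?_
      linarith
  have h1 : ∀ j : ℕ, ∫ u in (0 : ℝ)..1, truncPow n (t - u - j) =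
      (truncPow (n + 1) (t - j) - truncPow (n + 1) (t - (j + 1))) / (n + 1) := fun j => by
    have h2 := intervalIntegral.integral_comp_sub_left (a := 0) (b := 1) (truncPow n) (t - j)
    rw [integral_truncPow, sub_zero, sub_sub t] at h2
    rw [← h2]
    refine intervalIntegral.integral_congr fun u _ => ?_
    congr 1
    ring
  simp only [altTruncPow]
  rw [intervalIntegral.integral_finsetSum fun j _ => (hi j).const_mul _]
  simp only [intervalIntegral.integral_const_mul, h1]
  have h2 := Finset.sum_choose_succ_mul (fun j _ => (-1) ^ j * truncPow (n + 1) (t - j)) n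
  have h3 : ∀ j : ℕ, (-1) ^ j * ((n + 1).choose j : ℝ) * truncPow (n + 1) (t - j) =
      ((n + 1).choose j : ℝ) * ((-1) ^ j * truncPow (n + 1) (t - j)) := fun j => by ring
  rw [Finset.sum_congr rfl fun j _ => h3 j, h2, ← Finset.sum_add_distrib, Finset.sum_div]
  refine Finset.sum_congr rfl fun j _ => ?_
  push_cast
  ring

theorem conv_real_Iic (μ ν : Measure ℝ) [IsProbabilityMeasure μ] [IsProbabilityMeasure ν] (t : ℝ) :
    (μ.conv ν).real (Set.Iic t) = ∫ u, ν.real (Set.Iic (t - u)) ∂μ := by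
  rw [← integral_indicator_one measurableSet_Iic, integral_conv]
  · refine integral_congr_ae (Filter.Eventually.of_forall fun u => ?_)
    simp only
    rw [← integral_indicator_one measurableSet_Iic]
    refine integral_congr_ae (Filter.Eventually.of_forall fun v => ?_)
    simp only [Set.indicator, Set.mem_Iic, le_sub_iff_add_le', Pi.one_apply]
  · exact (integrable_const 1).indicator measurableSet_Iic

/-- The uniform distribution on the unit interval, as a measure on the line. -/
noncomputable def unifMeasure : Measure ℝ := volume.restrict (Set.Icc 0 1)

instance : IsProbabilityMeasure unifMeasure := ⟨by simp [unifMeasure]⟩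

/-- The law of the sum of `n` independent uniform variables (Irwin-Hall distribution). -/
noncomputable def irwinHall : ℕ → Measure ℝ
  | 0 => Measure.dirac 0
  | n + 1 => unifMeasure.conv (irwinHall n)

instance (n : ℕ) : IsProbabilityMeasure (irwinHall n) := by
  induction n with
  | zero => exact inferInstanceAs (IsProbabilityMeasure (Measure.dirac 0))
  | succ n ih => exact inferInstanceAs (IsProbabilityMeasure (unifMeasure.conv (irwinHall n)))

theorem irwinHall_real_Iic (n : ℕ) (t : ℝ) :
    (irwinHall n).real (Set.Iic t) = altTruncPow n t / n.factorial := by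
  induction n generalizing t with
  | zero =>
    -- As `0 ^ 0 = 1`, `truncPow 0` is the step function with value `1` at the jump: the
    -- distribution function of the point mass at `0`.
    simp [irwinHall, altTruncPow, truncPow, measureReal_def, Set.indicator, apply_ite ENNReal.toReal]
  | succ n ih =>
    rw [irwinHall, conv_real_Iic]
    simp only [ih]
    rw [integral_div, unifMeasure, integral_Icc_eq_integral_Ioc,
      ← intervalIntegral.integral_of_le zero_le_one, integral_altTruncPow, Nat.factorial_succ,
      div_div]
    push_cast
    rfl

open unitInterval in
/-- Infinitely many independent uniform points of the unit interval. -/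
noncomputable def iidUnif : Measure (ℕ → I) := Measure.infinitePi fun _ => volume

instance : IsProbabilityMeasure iidUnif := by unfold iidUnif; infer_instance

open unitInterval

/-- The sum of the first `n` coordinates. -/
noncomputable def partialSum (n : ℕ) (ω : ℕ → I) : ℝ := ∑ k ∈ Finset.range n, (ω k : ℝ)

theorem measurable_partialSum (n : ℕ) : Measurable (partialSum n) := by
  unfold partialSum
  fun_prop

theorem iIndepFun_coe_eval : iIndepFun (fun (k : ℕ) (ω : ℕ → I) => (ω k : ℝ)) iidUnif :=
  iIndepFun_infinitePi (X := fun _ (x : I) => (x : ℝ)) fun _ => measurable_subtype_coe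

theorem map_coe_eval (k : ℕ) : iidUnif.map (fun ω : ℕ → I => (ω k : ℝ)) = unifMeasure := by
  have h : iidUnif.map (fun ω : ℕ → I => ω k) = volume := Measure.infinitePi_map_eval _ k
  have h2 := Measure.map_map (μ := iidUnif) (g := ((↑) : I → ℝ)) (f := fun ω : ℕ → I => ω k)
    measurable_subtype_coe (measurable_pi_apply k)
  rw [h] at h2
  rw [unifMeasure, ← map_comap_subtype_coe measurableSet_Icc]
  exact h2.symm

theorem map_partialSum (n : ℕ) : iidUnif.map (partialSum n) = irwinHall n := by
  induction n with
  | zero =>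
    have : partialSum 0 = fun _ => 0 := by ext; simp [partialSum]
    rw [this, Measure.map_const, measure_univ, one_smul]
    rfl
  | succ n ih =>
    have h := iIndepFun_coe_eval.indepFun_finsetSum_of_notMem (fun k => by fun_prop)
      (Finset.notMem_range_self (n := n))
    have h1 : partialSum (n + 1) = (fun ω : ℕ → I => (ω n : ℝ)) + partialSum n := by
      ext ω
      simp [partialSum, Finset.sum_range_succ, add_comm]
    have h2 : (∑ j ∈ Finset.range n, fun ω : ℕ → I => (ω j : ℝ)) = partialSum n := by
      ext ω
      simp [partialSum]
    rw [h2] at h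
    rw [h1, h.symm.map_add_eq_map_conv_map (by fun_prop) (measurable_partialSum n), ih,
      map_coe_eval]
    rfl

/-- Since `⌈s⌉₊ ≤ k` means `s ≤ k`, it suffices to compare the two distribution functions at natural
numbers. -/
theorem map_numRows_eq_map_ceil (n : ℕ) :
    (uniform n).map (fun T => T.numRows) = iidUnif.map fun ω => ⌈partialSum n ω⌉₊ := by
  have hm : Measurable fun ω => ⌈partialSum n ω⌉₊ := (measurable_partialSum n).nat_ceil
  refine Measure.ext_of_Iic _ _ fun k => ?_
  rw [Measure.map_apply (by fun_prop) measurableSet_Iic, Measure.map_apply hm measurableSet_Iic]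
  have h1 : (fun ω => ⌈partialSum n ω⌉₊) ⁻¹' Set.Iic k = partialSum n ⁻¹' Set.Iic (k : ℝ) := by
    ext ω
    simp [Nat.ceil_le]
  rw [h1, ← Measure.map_apply (measurable_partialSum n) measurableSet_Iic, map_partialSum]
  refine (measureReal_eq_measureReal_iff).1 ?_
  rw [irwinHall_real_Iic, ← card_numRows_le, ← card_eq_factorial, measureReal_def, uniform,
    uniformOn_univ]
  have h2 : (fun T : PermutationTableau n => T.numRows) ⁻¹' Set.Iic k =
      ↑(Finset.univ.filter fun T : PermutationTableau n => T.numRows ≤ k) := by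
    ext T
    simp
  rw [h2, Measure.count_apply_finset, ENNReal.toReal_div]
  simp

end PermutationTableau

/-! ### The central limit theorem, with rounding and renormalization -/

namespace PermutationTableau

open MeasureTheory ProbabilityTheory Filter Topology unitInterval

/-- The centred and normalized coordinates, with mean `0` and variance `1`. -/
noncomputable def stdCoord (k : ℕ) (ω : ℕ → I) : ℝ := √12 * ((ω k : ℝ) - 1 / 2)

theorem measurable_coe_eval (k : ℕ) : Measurable fun ω : ℕ → I => (ω k : ℝ) := by
  fun_prop

theorem iIndepFun_stdCoord : iIndepFun stdCoord iidUnif :=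
  iIndepFun_coe_eval.comp (fun _ x => √12 * (x - 1 / 2)) fun _ => by fun_prop

theorem identDistrib_stdCoord (k : ℕ) : IdentDistrib (stdCoord k) (stdCoord 0) iidUnif iidUnif := by
  have h : IdentDistrib (fun ω : ℕ → I => (ω k : ℝ)) (fun ω : ℕ → I => (ω 0 : ℝ)) iidUnif iidUnif :=
    ⟨(measurable_coe_eval k).aemeasurable, (measurable_coe_eval 0).aemeasurable, by
      rw [map_coe_eval, map_coe_eval]⟩
  exact h.comp (u := fun x : ℝ => √12 * (x - 1 / 2)) (by fun_prop)

theorem integral_comp_coe_eval (f : ℝ → ℝ) (hf : Continuous f) (k : ℕ) :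
    ∫ ω, f (ω k : ℝ) ∂iidUnif = ∫ x in (0 : ℝ)..1, f x := by
  rw [← integral_map (μ := iidUnif) (φ := fun ω : ℕ → I => (ω k : ℝ)) (f := f)
    (measurable_coe_eval k).aemeasurable hf.aestronglyMeasurable, map_coe_eval, unifMeasure,
    integral_Icc_eq_integral_Ioc, ← intervalIntegral.integral_of_le zero_le_one]

theorem integral_stdCoord : ∫ ω, stdCoord 0 ω ∂iidUnif = 0 := by
  refine (integral_comp_coe_eval (fun x => √12 * (x - 1 / 2)) (by fun_prop) 0).trans ?_
  rw [intervalIntegral.integral_const_mul,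
    intervalIntegral.integral_comp_sub_right (fun x : ℝ => x), integral_id]
  norm_num

theorem integral_stdCoord_sq : ∫ ω, (stdCoord 0 ^ 2) ω ∂iidUnif = 1 := by
  refine (integral_comp_coe_eval (fun x => (√12 * (x - 1 / 2)) ^ 2) (by fun_prop) 0).trans ?_
  simp only [mul_pow]
  rw [intervalIntegral.integral_const_mul,
    intervalIntegral.integral_comp_sub_right (fun x : ℝ => x ^ 2), integral_pow,
    Real.sq_sqrt (by norm_num)]
  norm_num

theorem tendstoInDistribution_stdCoord :
    TendstoInDistribution (fun (n : ℕ) ω => (√n)⁻¹ * ∑ k ∈ Finset.range n, stdCoord k ω) atTop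
      (id : ℝ → ℝ) (fun _ => iidUnif) (gaussianReal 0 1) :=
  tendstoInDistribution_inv_sqrt_mul_sum HasLaw.id integral_stdCoord integral_stdCoord_sq
    iIndepFun_stdCoord identDistrib_stdCoord

theorem sum_stdCoord (n : ℕ) (ω : ℕ → I) :
    ∑ k ∈ Finset.range n, stdCoord k ω = √12 * (partialSum n ω - n / 2) := by
  simp only [stdCoord, ← Finset.mul_sum, Finset.sum_sub_distrib, partialSum, Finset.sum_const,
    Finset.card_range, nsmul_eq_mul]
  ring

/-- The normalization of the number of rows in tableaux of length `n`. -/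
noncomputable def normalize (n : ℕ) (x : ℝ) : ℝ := (x - ((n : ℝ) + 1) / 2) / √(((n : ℝ) + 1) / 12)

theorem partialSum_mem_Icc (n : ℕ) (ω : ℕ → I) : partialSum n ω ∈ Set.Icc (0 : ℝ) n := by
  refine ⟨Finset.sum_nonneg fun k _ => (ω k).2.1, ?_⟩
  calc partialSum n ω ≤ ∑ k ∈ Finset.range n, (1 : ℝ) := Finset.sum_le_sum fun k _ => (ω k).2.2
    _ = n := by simp

theorem abs_normalize_ceil_sub_le {n : ℕ} (hn : 0 < n) {s : ℝ} (hs : s ∈ Set.Icc (0 : ℝ) n) :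
    |normalize n (⌈s⌉₊ : ℝ) - (√n)⁻¹ * (√12 * (s - n / 2))| ≤ 2 * √12 * (√n)⁻¹ := by
  have hn' : (0 : ℝ) < n := by exact_mod_cast hn
  set p := √(n : ℝ) with hp
  set q := √((n : ℝ) + 1) with hq
  have hp0 : 0 < p := Real.sqrt_pos.2 hn'
  have hpp : p ^ 2 = n := Real.sq_sqrt hn'.le
  have hqq : q ^ 2 = n + 1 := Real.sq_sqrt (by linarith)
  have hpq : p ≤ q := Real.sqrt_le_sqrt (by linarith)
  have hq0 : 0 < q := hp0.trans_le hpq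
  have hc0 : 0 < √(12 : ℝ) := by positivity
  -- The first term is the rounding error, shifted by the `1 / 2` in the centring; the second comes
  -- from replacing `√n` by `√(n + 1)`.
  have e : normalize n (⌈s⌉₊ : ℝ) - p⁻¹ * (√12 * (s - n / 2)) =
      √12 * (((⌈s⌉₊ : ℝ) - s - 1 / 2) * q⁻¹ - (s - n / 2) * (p⁻¹ - q⁻¹)) := by
    rw [normalize, Real.sqrt_div (by linarith), ← hq]
    field_simp
    ring
  have h1 : |(⌈s⌉₊ : ℝ) - s - 1 / 2| ≤ 1 := by
    have h2 := Nat.le_ceil s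
    have h3 := Nat.ceil_lt_add_one hs.1
    rw [abs_le]
    constructor <;> linarith
  have h2 : q⁻¹ ≤ p⁻¹ := inv_anti₀ hp0 hpq
  have h3 : n * (p⁻¹ - q⁻¹) ≤ p⁻¹ := by
    rw [← hpp]
    -- Because `(q + p) * (q - p) = 1`.
    have h4 : p * (q - p) ≤ 1 := by nlinarith
    have h5 : p ^ 2 * (p⁻¹ - q⁻¹) = p * (q - p) * q⁻¹ := by
      field_simp
    rw [h5]
    exact (mul_le_of_le_one_left (by positivity) h4).trans h2
  have h4 : |s - n / 2| ≤ n := by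
    rw [abs_le]
    constructor <;> linarith [hs.1, hs.2]
  rw [e, abs_mul, abs_of_pos hc0, mul_comm (2 : ℝ), mul_assoc]
  refine mul_le_mul_of_nonneg_left ?_ hc0.le
  refine (abs_sub _ _).trans ?_
  rw [abs_mul, abs_mul, abs_of_pos (inv_pos.2 hq0), abs_of_nonneg (sub_nonneg.2 h2)]
  have h5 := mul_le_mul_of_nonneg_right h1 (inv_pos.2 hq0).le
  have h6 := mul_le_mul_of_nonneg_right h4 (sub_nonneg.2 h2)
  linarith

theorem measurable_normalize (n : ℕ) : Measurable (normalize n) := by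
  unfold normalize
  fun_prop

theorem measurable_ceil_partialSum (n : ℕ) : Measurable fun ω => (⌈partialSum n ω⌉₊ : ℝ) :=
  measurable_from_nat.comp (measurable_partialSum n).nat_ceil

/-- Slutsky's theorem: the difference from the standardized sum has a deterministic bound of order
`1 / √n`. -/
theorem tendstoInDistribution_ceil_partialSum :
    TendstoInDistribution (fun (n : ℕ) ω => normalize n (⌈partialSum n ω⌉₊ : ℝ)) atTop
      (id : ℝ → ℝ) (fun _ => iidUnif) (gaussianReal 0 1) := by
  have hm : ∀ n, Measurable fun ω => normalize n (⌈partialSum n ω⌉₊ : ℝ) := fun n =>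
    (measurable_normalize n).comp (measurable_ceil_partialSum n)
  refine tendstoInDistribution_of_tendstoInMeasure_sub _ _ tendstoInDistribution_stdCoord ?_
    fun n => (hm n).aemeasurable
  refine tendstoInMeasure_of_tendsto_ae (fun n => ?_) (Eventually.of_forall fun ω => ?_)
  · have h := tendstoInDistribution_stdCoord.forall_aemeasurable n
    exact ((hm n).aemeasurable.sub h).aestronglyMeasurable
  · have hlim : Tendsto (fun n : ℕ => 2 * √12 * (√(n : ℝ))⁻¹) atTop (𝓝 0) := by
      have := (tendsto_inv_atTop_zero.comp
        (Real.tendsto_sqrt_atTop.comp tendsto_natCast_atTop_atTop)).const_mul (2 * √12)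
      simpa using this
    refine squeeze_zero_norm' ?_ hlim
    filter_upwards [eventually_gt_atTop 0] with n hn
    simp only [Pi.sub_apply, sum_stdCoord, Real.norm_eq_abs]
    exact abs_normalize_ceil_sub_le hn (partialSum_mem_Icc n ω)

theorem map_normalize_numRows (n : ℕ) :
    (uniform n).map (fun T => normalize n T.numRows) =
      iidUnif.map fun ω => normalize n (⌈partialSum n ω⌉₊ : ℝ) := by
  have hg : Measurable fun k : ℕ => normalize n k := measurable_from_nat
  have h1 := Measure.map_map (μ := uniform n) (f := fun T => T.numRows) hg (by fun_prop)
  have h2 := Measure.map_map (μ := iidUnif) hg (measurable_partialSum n).nat_ceil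
  rw [map_numRows_eq_map_ceil, h2] at h1
  exact h1.symm

end PermutationTableau

theorem mainTheorem4 :
    MeasureTheory.TendstoInDistribution
      (fun (n : ℕ) (T : PermutationTableau n) =>
        ((T.numRows : ℝ) - ((n : ℝ) + 1) / 2) / Real.sqrt (((n : ℝ) + 1) / 12))
      Filter.atTop (id : ℝ → ℝ) PermutationTableau.uniform
      (ProbabilityTheory.gaussianReal 0 1) where
  forall_aemeasurable n := by fun_prop
  aemeasurable_limit := by fun_prop
  tendsto := by
    -- Convergence in distribution depends only on the laws, and these coincide for every `n`.
    refine PermutationTableau.tendstoInDistribution_ceil_partialSum.tendsto.congr fun n => ?_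
    exact Subtype.ext (PermutationTableau.map_normalize_numRows n).symm
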